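/- **Definition.** Let $f$ be a real-valued function on a subset $U$ of $\mathbb{R}^n$. A sequence $(x_k)_{k\ge 0}$ in $U$ is a *BFGS sequence* for $f$ if $f$ is differentiable at each $x_k$ with $\nabla f(x_k)\neq 0$, and there exist parameters $0<\mu<\nu<1$ and a positive definite $n\times n$ matrix $H_0$ such that, with $$s_k=x_{k+1}-x_k,\qquad y_k=\nabla f(x_{k+1})-\nabla f(x_k),$$ $$W_k=I-\frac{s_ky_k^T}{s_k^Ty_k},\qquad H_{k+1}=W_kH_kW_k^T+\frac{s_ks_k^T}{s_k^Ty_k},$$ the following hold for all $k=0,1,2,\dots$: $$H_k\nabla f(x_k)\in-\mathbb{R}_+s_k,\qquad f(x_{k+1})\le f(x_k)+\mu\nabla f(x_k)^Ts_k,\qquad \nabla f(x_{k+1})^Ts_k\ge\nu\nabla f(x_k)^Ts_k .$$ (These conditions force $s_k^Ty_k>0$, so that the matrices $H_k$ are well defined.) **Theorem.** Let $U\subset\mathbb{R}^n$ be an open convex set containing a BFGS sequence $(x_k)$ for a convex function $f\colon U\to\mathbb{R}$. Assume that the level set $\{x\in U: f(x)\le f(x_0)\}$ is bounded, and that there is an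 open set $V\subset U$ that contains the closure (in $\mathbb{R}^n$) of the set of iterates $\{x_k : k\ge 0\}$, satisfies $\inf_V f=\inf_U f$, and throughout which the Hessian $\nabla^2 f$ exists, is continuous and is positive definite. Then $f$ attains its minimum over $U$, and $f(x_k)\to\min_U f$ as $k\to\infty$. -/

import Mathlib

open Filter Topology
open scoped Gradient

noncomputable section

/-- The BFGS update of an approximate inverse Hessian `H` for the step `s` and the gradient
increment `y`: with `W = I - s yᵀ / (sᵀ y)` it is `W H Wᵀ + s sᵀ / (sᵀ y)`. -/
def bfgsUpdate {n : ℕ} (H : Matrix (Fin n) (Fin n) ℝ) (s y : EuclideanSpace ℝ (Fin n)) :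
    Matrix (Fin n) (Fin n) ℝ :=
  (1 - (inner ℝ s y)⁻¹ • Matrix.vecMulVec s.ofLp y.ofLp) * H *
      (1 - (inner ℝ s y)⁻¹ • Matrix.vecMulVec s.ofLp y.ofLp).transpose +
    (inner ℝ s y)⁻¹ • Matrix.vecMulVec s.ofLp s.ofLp

/-- The matrices `H₀, H₁, …` generated from `H₀` along the sequence `x` by the BFGS updates with
`s_k = x_{k+1} - x_k` and `y_k = ∇f(x_{k+1}) - ∇f(x_k)`. -/
def bfgsMatrix {n : ℕ} (f : EuclideanSpace ℝ (Fin n) → ℝ) (x : ℕ → EuclideanSpace ℝ (Fin n))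
    (H₀ : Matrix (Fin n) (Fin n) ℝ) : ℕ → Matrix (Fin n) (Fin n) ℝ
  | 0 => H₀
  | k + 1 => bfgsUpdate (bfgsMatrix f x H₀ k) (x (k + 1) - x k) (∇ f (x (k + 1)) - ∇ f (x k))

/-- `x` is a BFGS sequence for `f`: the BFGS method could generate it using a line search
satisfying the Armijo and weak Wolfe conditions. -/
def IsBFGSSequence {n : ℕ} (f : EuclideanSpace ℝ (Fin n) → ℝ)
    (x : ℕ → EuclideanSpace ℝ (Fin n)) : Prop :=
  (∀ k, DifferentiableAt ℝ f (x k) ∧ ∇ f (x k) ≠ 0) ∧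
  ∃ (μ ν : ℝ) (H₀ : Matrix (Fin n) (Fin n) ℝ),
    0 < μ ∧ μ < ν ∧ ν < 1 ∧ H₀.PosDef ∧
    ∀ k,
      -- the step is a nonnegative multiple of the approximate Newton direction
      (∃ t : ℝ, 0 ≤ t ∧
        (bfgsMatrix f x H₀ k).mulVec (∇ f (x k)).ofLp = -(t • (x (k + 1) - x k).ofLp)) ∧
      -- Armijo condition
      f (x (k + 1)) ≤ f (x k) + μ * inner ℝ (∇ f (x k)) (x (k + 1) - x k) ∧
      -- weak Wolfe condition
      inner ℝ (∇ f (x (k + 1))) (x (k + 1) - x k) ≥ ν * inner ℝ (∇ f (x k)) (x (k + 1) - x k)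

/-- The Hessian matrix of `f` at `x`: the Jacobian matrix of the gradient. -/
def hessian {n : ℕ} (f : EuclideanSpace ℝ (Fin n) → ℝ) (x : EuclideanSpace ℝ (Fin n)) :
    Matrix (Fin n) (Fin n) ℝ :=
  Matrix.of fun i j => (fderiv ℝ (∇ f) x (EuclideanSpace.single j 1)) i

/-- `f` is twice differentiable at every point of `V` and its Hessian is continuous and positive
definite throughout `V`. -/
def HasContinuousPosDefHessianOn {n : ℕ} (f : EuclideanSpace ℝ (Fin n) → ℝ)
    (V : Set (EuclideanSpace ℝ (Fin n))) : Prop :=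
  (∀ z ∈ V, DifferentiableAt ℝ f z ∧ DifferentiableAt ℝ (∇ f) z) ∧
  ContinuousOn (hessian f) V ∧
  ∀ z ∈ V, (hessian f z).PosDef

end

/-! Write `B = H⁻¹`, `g = ∇f(x_k)`, `p = -gᵀs`. The Armijo condition makes `f(x_k)` decrease and
forces `p → 0`. The potential `tr B - log det B` is nonnegative, and `bfgsPotential_update_le`
bounds its increment by a constant minus `log (|g|²/p)`, provided `|y|² ≤ M sᵀy`. Were `|g|` bounded
away from zero, the potential would tend to `-∞`. So by compactness `∇f` vanishes somewhere on the
closure of the iterates; by convexity that point is a global minimizer, and monotonicity of `f(x_k)`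
gives convergence. The bound `|y|² ≤ M sᵀy` is delicate because steps may cross regions where `f` is
not smooth; `exists_cocoercive` gets it from convexity. -/

theorem inner_eq_dotProduct {n : ℕ} (u v : EuclideanSpace ℝ (Fin n)) :
    inner ℝ u v = u.ofLp ⬝ᵥ v.ofLp := by
  simp [EuclideanSpace.inner_eq_star_dotProduct, dotProduct_comm]

/-! ### The BFGS update and its inverse -/

open Matrix in
/-- The BFGS update of an approximate Hessian `B`, which is the inverse of an approximate inverse
Hessian: `B - B s sᵀ B / (sᵀ B s) + y yᵀ / (sᵀ y)`. -/
noncomputable def bfgsDirectUpdate {n : ℕ} (B : Matrix (Fin n) (Fin n) ℝ) (s y : Fin n → ℝ) :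
    Matrix (Fin n) (Fin n) ℝ :=
  B - (s ⬝ᵥ B *ᵥ s)⁻¹ • vecMulVec (B *ᵥ s) (B *ᵥ s) + (s ⬝ᵥ y)⁻¹ • vecMulVec y y

open Matrix in
theorem bfgsUpdate_eq {n : ℕ} (H : Matrix (Fin n) (Fin n) ℝ) (s y : EuclideanSpace ℝ (Fin n)) :
    bfgsUpdate H s y =
      (1 - (s.ofLp ⬝ᵥ y.ofLp)⁻¹ • vecMulVec s.ofLp y.ofLp) * H *
        (1 - (s.ofLp ⬝ᵥ y.ofLp)⁻¹ • vecMulVec s.ofLp y.ofLp)ᵀ +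
      (s.ofLp ⬝ᵥ y.ofLp)⁻¹ • vecMulVec s.ofLp s.ofLp := by
  rw [bfgsUpdate, inner_eq_dotProduct]

-- The quadratic form is `(Wᵀv)ᵀH(Wᵀv) + (sᵀv)²/sᵀy`; where the second term vanishes, `Wᵀv = v`.
open Matrix in
theorem bfgsUpdate_posDef {n : ℕ} {H : Matrix (Fin n) (Fin n) ℝ} (hH : H.PosDef)
    {s y : EuclideanSpace ℝ (Fin n)} (hsy : 0 < s.ofLp ⬝ᵥ y.ofLp) :
    (bfgsUpdate H s y).PosDef := by
  rw [bfgsUpdate_eq]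
  set ρ := s.ofLp ⬝ᵥ y.ofLp
  set W := 1 - ρ⁻¹ • vecMulVec s.ofLp y.ofLp with hW
  have hWT : ∀ v, Wᵀ *ᵥ v = v - (ρ⁻¹ * (s.ofLp ⬝ᵥ v)) • y.ofLp := by
    intro v
    rw [hW, transpose_sub, transpose_one, transpose_smul, transpose_vecMulVec, sub_mulVec,
      one_mulVec, smul_mulVec, vecMulVec_mulVec]
    simp [smul_smul]
  have hHs : Hᵀ = H := by simpa using hH.isHermitian.eq
  refine PosDef.of_dotProduct_mulVec_pos ?_ ?_
  · ext i j
    have h1 : (W * H * Wᵀ)ᵀ = W * H * Wᵀ := by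
      simp [transpose_mul, hHs, Matrix.mul_assoc]
    have h2 := congrFun (congrFun h1 i) j
    simp only [transpose_apply] at h2
    simp [conjTranspose_apply, vecMulVec_apply, h2, mul_comm]
  · intro v hv
    have e : star v ⬝ᵥ (W * H * Wᵀ + ρ⁻¹ • vecMulVec s.ofLp s.ofLp) *ᵥ v =
        (Wᵀ *ᵥ v) ⬝ᵥ H *ᵥ (Wᵀ *ᵥ v) + ρ⁻¹ * (s.ofLp ⬝ᵥ v) ^ 2 := by
      rw [add_mulVec, dotProduct_add, smul_mulVec, vecMulVec_mulVec, ← mulVec_mulVec,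
        ← mulVec_mulVec, dotProduct_mulVec (star v) W, ← mulVec_transpose]
      simp [dotProduct_comm v, sq]
    rw [e]
    by_cases h : s.ofLp ⬝ᵥ v = 0
    · have h3 : Wᵀ *ᵥ v = v := by simp [hWT, h]
      have := hH.dotProduct_mulVec_pos hv
      simpa [h3, h] using this
    · have h4 := hH.posSemidef.dotProduct_mulVec_nonneg (Wᵀ *ᵥ v)
      have h5 : 0 < ρ⁻¹ * (s.ofLp ⬝ᵥ v) ^ 2 := by positivity
      simp only [star_trivial] at h4
      linarith

-- The secant equation `sᵀB₊ = yᵀ` for the updated `B₊` reduces `WᵀB₊` to `B` minus one rank-one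
-- term; the remaining rank-one terms cancel.
open Matrix in
theorem bfgsUpdate_mul_direct {n : ℕ} {H B : Matrix (Fin n) (Fin n) ℝ} (hHB : H * B = 1)
    (hB : Bᵀ = B) {s y : EuclideanSpace ℝ (Fin n)} (hsy : s.ofLp ⬝ᵥ y.ofLp ≠ 0)
    (hs : s.ofLp ⬝ᵥ B *ᵥ s.ofLp ≠ 0) :
    bfgsUpdate H s y * bfgsDirectUpdate B s.ofLp y.ofLp = 1 := by
  rw [bfgsUpdate_eq, bfgsDirectUpdate]
  generalize s.ofLp = s at *
  generalize y.ofLp = y at *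
  set ρ := s ⬝ᵥ y with hρ
  set σ := s ⬝ᵥ B *ᵥ s with hσ
  have hsB : s ᵥ* B = B *ᵥ s := by rw [← mulVec_transpose, hB]
  have hHBs : H *ᵥ (B *ᵥ s) = s := by rw [mulVec_mulVec, hHB, one_mulVec]
  have secant : s ᵥ* (B - σ⁻¹ • vecMulVec (B *ᵥ s) (B *ᵥ s) + ρ⁻¹ • vecMulVec y y) = y := by
    rw [vecMul_add, vecMul_sub, vecMul_smul, vecMul_smul, vecMul_vecMulVec, vecMul_vecMulVec, hsB,
      ← hσ, ← hρ, smul_smul, smul_smul, inv_mul_cancel₀ hs, inv_mul_cancel₀ hsy]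
    simp
  have e1 : (1 - ρ⁻¹ • vecMulVec s y)ᵀ *
      (B - σ⁻¹ • vecMulVec (B *ᵥ s) (B *ᵥ s) + ρ⁻¹ • vecMulVec y y) =
      B - σ⁻¹ • vecMulVec (B *ᵥ s) (B *ᵥ s) := by
    rw [transpose_sub, transpose_one, transpose_smul, transpose_vecMulVec, Matrix.sub_mul,
      Matrix.one_mul, Matrix.smul_mul, vecMulVec_mul, secant]
    abel
  have e2 : H * (B - σ⁻¹ • vecMulVec (B *ᵥ s) (B *ᵥ s)) = 1 - σ⁻¹ • vecMulVec s (B *ᵥ s) := by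
    rw [Matrix.mul_sub, hHB, Matrix.mul_smul, mul_vecMulVec, hHBs]
  rw [Matrix.add_mul, Matrix.mul_assoc, Matrix.mul_assoc, e1, e2, Matrix.smul_mul, vecMulVec_mul,
    secant, Matrix.sub_mul, Matrix.one_mul, Matrix.mul_sub, Matrix.mul_one, Matrix.smul_mul,
    Matrix.mul_smul, vecMulVec_mul_vecMulVec, dotProduct_comm y s, ← hρ, vecMulVec_smul,
    smul_comm σ⁻¹ ρ, smul_smul, inv_mul_cancel₀ hsy, one_smul]
  abel

open Matrix in
theorem trace_bfgsDirectUpdate {n : ℕ} (B : Matrix (Fin n) (Fin n) ℝ) (s y : Fin n → ℝ) :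
    (bfgsDirectUpdate B s y).trace =
      B.trace - (s ⬝ᵥ B *ᵥ s)⁻¹ * (B *ᵥ s ⬝ᵥ B *ᵥ s) + (s ⬝ᵥ y)⁻¹ * (y ⬝ᵥ y) := by
  simp [bfgsDirectUpdate, trace_add, trace_sub, trace_smul, trace_vecMulVec]

-- The update is `B(1 + PQ)` with `P` having two columns, so `det (1 + PQ) = det (1 + QP)` leaves a
-- 2×2 determinant whose upper left entry is zero.
open Matrix in
theorem det_bfgsDirectUpdate {n : ℕ} {H B : Matrix (Fin n) (Fin n) ℝ} (hHB : H * B = 1)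
    (hB : Bᵀ = B) {s y : Fin n → ℝ} (hsy : s ⬝ᵥ y ≠ 0) (hs : s ⬝ᵥ B *ᵥ s ≠ 0) :
    (bfgsDirectUpdate B s y).det = B.det * ((s ⬝ᵥ y) / (s ⬝ᵥ B *ᵥ s)) := by
  have hBH : B * H = 1 := mul_eq_one_comm.mp hHB
  set ρ := s ⬝ᵥ y with hρ
  set σ := s ⬝ᵥ B *ᵥ s with hσ
  let P : Matrix (Fin n) (Fin 2) ℝ := of fun i j => ![s i, (H *ᵥ y) i] j
  let Q : Matrix (Fin 2) (Fin n) ℝ := of fun j i => ![-(σ⁻¹ * (B *ᵥ s) i), ρ⁻¹ * y i] j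
  have hfac : bfgsDirectUpdate B s y = B * (1 + P * Q) := by
    have hPQ : P * Q = -(σ⁻¹ • vecMulVec s (B *ᵥ s)) + ρ⁻¹ • vecMulVec (H *ᵥ y) y := by
      ext i j
      simp [P, Q, Matrix.mul_apply, Fin.sum_univ_two, vecMulVec_apply]
      ring
    rw [hPQ, Matrix.mul_add, Matrix.mul_add, Matrix.mul_neg, Matrix.mul_smul, Matrix.mul_smul,
      mul_vecMulVec, mul_vecMulVec, mulVec_mulVec, hBH, one_mulVec, Matrix.mul_one,
      bfgsDirectUpdate, ← hρ, ← hσ]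
    abel
  have q0 : ∀ v, (Q *ᵥ v) 0 = -(σ⁻¹ * (B *ᵥ s ⬝ᵥ v)) := by
    intro v
    change ∑ j, Q 0 j * v j = _
    rw [dotProduct, Finset.mul_sum, ← Finset.sum_neg_distrib]
    exact Finset.sum_congr rfl fun i _ => by simp [Q, mul_assoc]
  have q1 : ∀ v, (Q *ᵥ v) 1 = ρ⁻¹ * (y ⬝ᵥ v) := by
    intro v
    change ∑ j, Q 1 j * v j = _
    rw [dotProduct, Finset.mul_sum]
    exact Finset.sum_congr rfl fun i _ => by simp [Q, mul_assoc]
  have c0 : ∀ i, (Q * P) i 0 = (Q *ᵥ s) i := fun i => by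
    simp [Matrix.mul_apply, mulVec, dotProduct, P]
  have c1 : ∀ i, (Q * P) i 1 = (Q *ᵥ (H *ᵥ y)) i := fun i => by
    simp [Matrix.mul_apply, mulVec, dotProduct, P]
  have hcross : B *ᵥ s ⬝ᵥ H *ᵥ y = ρ := by
    rw [← vecMul_transpose, hB, ← dotProduct_mulVec, mulVec_mulVec, hBH, one_mulVec]
  rw [hfac, det_mul, det_one_add_mul_comm, det_fin_two]
  simp only [Matrix.add_apply, c0, c1, q0, q1, hcross, dotProduct_comm (B *ᵥ s) s,
    dotProduct_comm y s, ← hρ, ← hσ]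
  simp only [one_apply_eq, ne_eq, zero_ne_one, one_ne_zero, not_false_eq_true, one_apply_ne]
  field_simp
  ring

/-! ### The potential and its change along a step -/

-- Sum `log λ ≤ λ - 1` over the eigenvalues.
open Matrix in
theorem Matrix.PosDef.log_det_le_trace {n : ℕ} {B : Matrix (Fin n) (Fin n) ℝ} (hB : B.PosDef) :
    Real.log B.det ≤ B.trace := by
  have h1 := hB.isHermitian.det_eq_prod_eigenvalues
  have h2 := hB.isHermitian.trace_eq_sum_eigenvalues
  simp only [RCLike.ofReal_real_eq_id, id] at h1 h2
  rw [h1, h2, Real.log_prod (fun i _ => (hB.eigenvalues_pos i).ne')]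
  refine Finset.sum_le_sum fun i _ => ?_
  have := Real.log_le_sub_one_of_pos (hB.eigenvalues_pos i)
  linarith

/-- The Byrd–Nocedal potential `tr B - log det B` of the inverse `B` of `H`. -/
noncomputable def bfgsPotential {n : ℕ} (H : Matrix (Fin n) (Fin n) ℝ) : ℝ :=
  H⁻¹.trace - Real.log H⁻¹.det

theorem bfgsPotential_nonneg {n : ℕ} {H : Matrix (Fin n) (Fin n) ℝ} (hH : H.PosDef) :
    0 ≤ bfgsPotential H :=
  sub_nonneg.2 hH.inv.log_det_le_trace

open Matrix in
theorem bfgs_step_descent {n : ℕ} {H : Matrix (Fin n) (Fin n) ℝ} (hH : H.PosDef)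
    {g s : EuclideanSpace ℝ (Fin n)} {t : ℝ} (ht : 0 ≤ t) (hg : g ≠ 0)
    (hs : H *ᵥ g.ofLp = -(t • s.ofLp)) : 0 < t ∧ inner ℝ g s < 0 := by
  have hg' : g.ofLp ≠ 0 := fun h => hg (by ext i; simp [h])
  have h1 := hH.dotProduct_mulVec_pos hg'
  rw [hs, star_trivial, dotProduct_neg, dotProduct_smul, smul_eq_mul, ← inner_eq_dotProduct] at h1
  have h2 : t ≠ 0 := by rintro rfl; simp at h1
  have h3 : 0 < t := lt_of_le_of_ne ht h2.symm
  exact ⟨h3, by by_contra h; nlinarith [mul_nonneg ht (not_lt.1 h)]⟩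

open Matrix in
/-- The potential decreases along a step of the method when `|g|² / (-gᵀs)` is large. -/
theorem bfgsPotential_update_le {n : ℕ} {H : Matrix (Fin n) (Fin n) ℝ} (hH : H.PosDef)
    {g s y : EuclideanSpace ℝ (Fin n)} {t ν M : ℝ} (ht : 0 ≤ t) (hg : g ≠ 0)
    (hs : H *ᵥ g.ofLp = -(t • s.ofLp)) (hν : ν < 1)
    (hwolfe : (1 - ν) * -inner ℝ g s ≤ inner ℝ s y) (hM : ‖y‖ ^ 2 ≤ M * inner ℝ s y) :
    bfgsPotential (bfgsUpdate H s y) ≤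
      bfgsPotential H + M - Real.log (1 - ν) - 1 - Real.log (‖g‖ ^ 2 / -inner ℝ g s) := by
  obtain ⟨htpos, hgs⟩ := bfgs_step_descent hH ht hg hs
  have hsy : 0 < inner ℝ s y :=
    lt_of_lt_of_le (mul_pos (sub_pos.2 hν) (neg_pos.2 hgs)) hwolfe
  set B := H⁻¹ with hBdef
  have hBpos : B.PosDef := hH.inv
  have hB : Bᵀ = B := by simpa using hBpos.isHermitian.eq
  have hdet : IsUnit H.det := hH.det_pos.ne'.isUnit
  have hHB : H * B = 1 := mul_nonsing_inv H hdet
  have hBH : B * H = 1 := nonsing_inv_mul H hdet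
  have hBs : B *ᵥ s.ofLp = -(t⁻¹ • g.ofLp) := by
    have h := congrArg (fun v => B *ᵥ v) hs
    simp only [mulVec_mulVec, hBH, one_mulVec, mulVec_neg, mulVec_smul] at h
    rw [h, smul_neg, neg_neg, smul_smul, inv_mul_cancel₀ htpos.ne', one_smul]
  set p := -inner ℝ g s with hp
  have hppos : 0 < p := neg_pos.2 hgs
  have hσ : s.ofLp ⬝ᵥ B *ᵥ s.ofLp = t⁻¹ * p := by
    rw [hBs, dotProduct_neg, dotProduct_smul, hp, inner_eq_dotProduct, dotProduct_comm]
    simp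
  have hσpos : 0 < s.ofLp ⬝ᵥ B *ᵥ s.ofLp := by rw [hσ]; positivity
  have hBs2 : B *ᵥ s.ofLp ⬝ᵥ B *ᵥ s.ofLp = t⁻¹ ^ 2 * ‖g‖ ^ 2 := by
    rw [hBs, ← real_inner_self_eq_norm_sq, inner_eq_dotProduct]
    simp [sq, mul_assoc]
  have hy2 : y.ofLp ⬝ᵥ y.ofLp = ‖y‖ ^ 2 := by
    rw [← real_inner_self_eq_norm_sq, inner_eq_dotProduct]
  have hsy' : 0 < s.ofLp ⬝ᵥ y.ofLp := by rwa [← inner_eq_dotProduct]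
  have hinv : (bfgsUpdate H s y)⁻¹ = bfgsDirectUpdate B s.ofLp y.ofLp :=
    inv_eq_right_inv (bfgsUpdate_mul_direct hHB hB hsy'.ne' hσpos.ne')
  rw [bfgsPotential, hinv, trace_bfgsDirectUpdate,
    det_bfgsDirectUpdate hHB hB hsy'.ne' hσpos.ne', bfgsPotential, ← hBdef,
    Real.log_mul hBpos.det_pos.ne' (div_pos hsy' hσpos).ne', hBs2, hσ, hy2, ← inner_eq_dotProduct]
  have hgpos : 0 < ‖g‖ := norm_pos_iff.2 hg
  have k1 : (inner ℝ s y)⁻¹ * ‖y‖ ^ 2 ≤ M := by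
    rw [inv_mul_eq_div, div_le_iff₀ hsy]; exact hM
  have k2 : (t⁻¹ * p)⁻¹ * (t⁻¹ ^ 2 * ‖g‖ ^ 2) = t⁻¹ * (‖g‖ ^ 2 / p) := by
    field_simp
  have k3 : Real.log (1 - ν) - Real.log t⁻¹ ≤ Real.log (inner ℝ s y / (t⁻¹ * p)) := by
    rw [← Real.log_div (sub_pos.2 hν).ne' (inv_pos.2 htpos).ne']
    refine Real.log_le_log (div_pos (sub_pos.2 hν) (inv_pos.2 htpos)) ?_
    rw [le_div_iff₀ (by positivity)]
    calc (1 - ν) / t⁻¹ * (t⁻¹ * p) = (1 - ν) * p := by field_simp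
      _ ≤ _ := hwolfe
  have hc : 0 < ‖g‖ ^ 2 / p := by positivity
  -- The unknown scale `t` enters as `-c/t + log t⁻¹` with `c = |g|²/p`; this is at most `-1 - log
  -- c`, which eliminates `t`.
  have k4 := Real.log_le_sub_one_of_pos (mul_pos (inv_pos.2 htpos) hc)
  rw [Real.log_mul (inv_pos.2 htpos).ne' hc.ne'] at k4
  rw [k2]
  linarith

/-! ### Gradients of convex functions and Hessian bounds -/

theorem hessian_mulVec {n : ℕ} (f : EuclideanSpace ℝ (Fin n) → ℝ)
    (z v : EuclideanSpace ℝ (Fin n)) :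
    (hessian f z).mulVec v.ofLp = (fderiv ℝ (∇ f) z v).ofLp := by
  ext i
  have hv : v = ∑ j, v j • EuclideanSpace.single j (1 : ℝ) := by
    ext i
    simp [Finset.sum_apply, Pi.single_apply]
  conv_rhs => rw [hv, map_sum]
  simp [Matrix.mulVec, dotProduct, hessian, mul_comm]

theorem ConvexOn.add_inner_gradient_le {n : ℕ} {U : Set (EuclideanSpace ℝ (Fin n))}
    {f : EuclideanSpace ℝ (Fin n) → ℝ} (hf : ConvexOn ℝ U f) {p q : EuclideanSpace ℝ (Fin n)}
    (hp : p ∈ U) (hq : q ∈ U) (hd : DifferentiableAt ℝ f p) :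
    f p + inner ℝ (∇ f p) (q - p) ≤ f q := by
  have hc := hf.comp_affineMap (AffineMap.lineMap p q : ℝ →ᵃ[ℝ] EuclideanSpace ℝ (Fin n))
  have h1 : HasFDerivAt f (fderiv ℝ f p) (AffineMap.lineMap p q (0 : ℝ)) := by
    simpa using hd.hasFDerivAt
  have h2 := h1.comp_hasDerivAt (0 : ℝ) (AffineMap.hasDerivAt_lineMap (a := p) (b := q))
  have h3 := hc.le_slope_of_hasDerivAt (x := 0) (y := 1) (by simpa using hp) (by simpa using hq)
    one_pos h2
  have h4 : inner ℝ (∇ f p) (q - p) = fderiv ℝ f p (q - p) := by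
    simp [gradient]
  simp [slope_def_field] at h3
  rw [h4, map_sub]
  linarith

theorem ConvexOn.inner_gradient_sub_nonneg {n : ℕ} {U : Set (EuclideanSpace ℝ (Fin n))}
    {f : EuclideanSpace ℝ (Fin n) → ℝ} (hf : ConvexOn ℝ U f) {p q : EuclideanSpace ℝ (Fin n)}
    (hp : p ∈ U) (hq : q ∈ U) (hdp : DifferentiableAt ℝ f p) (hdq : DifferentiableAt ℝ f q) :
    0 ≤ inner ℝ (∇ f q - ∇ f p) (q - p) := by
  have h1 := hf.add_inner_gradient_le hp hq hdp
  have h2 := hf.add_inner_gradient_le hq hp hdq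
  rw [← neg_sub q p, inner_neg_right] at h2
  rw [inner_sub_left]
  linarith

/-- A positive definite continuous Hessian has uniform bounds on compact sets. -/
theorem HasContinuousPosDefHessianOn.exists_bounds {n : ℕ} {f : EuclideanSpace ℝ (Fin n) → ℝ}
    {V K : Set (EuclideanSpace ℝ (Fin n))} (hess : HasContinuousPosDefHessianOn f V)
    (hK : IsCompact K) (hKV : K ⊆ V) :
    ∃ m L : ℝ, 0 < m ∧ ∀ z ∈ K, ‖fderiv ℝ (∇ f) z‖ ≤ L ∧
      ∀ v, m * ‖v‖ ^ 2 ≤ inner ℝ (fderiv ℝ (∇ f) z v) v := by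
  obtain ⟨-, hcont, hpos⟩ := hess
  have hD : ContinuousOn (fderiv ℝ (∇ f)) K := by
    have h1 : ∀ z, fderiv ℝ (∇ f) z =
        LinearMap.toContinuousLinearMap ((Matrix.toEuclideanLin (hessian f z))) := by
      intro z
      ext v i
      rw [← hessian_mulVec]
      simp [Matrix.toLpLin_apply]
    have h2 : Continuous fun A : Matrix (Fin n) (Fin n) ℝ =>
        LinearMap.toContinuousLinearMap (Matrix.toEuclideanLin A) :=
      LinearMap.continuous_of_finiteDimensional
        ((LinearMap.toContinuousLinearMap (𝕜 := ℝ)).toLinearMap ∘ₗ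
          (Matrix.toEuclideanLin (𝕜 := ℝ) (m := Fin n) (n := Fin n)).toLinearMap)
    exact (h2.comp_continuousOn (hcont.mono hKV)).congr fun z _ => h1 z
  obtain ⟨L, hL⟩ := hK.exists_bound_of_continuousOn hD
  have hpos' : ∀ z ∈ K, ∀ v ≠ 0, 0 < inner ℝ (fderiv ℝ (∇ f) z v) v := by
    intro z hz v hv
    have hv' : v.ofLp ≠ 0 := fun h => hv (by ext i; simp [h])
    have := (hpos z (hKV hz)).dotProduct_mulVec_pos hv'
    rwa [hessian_mulVec, star_trivial, ← inner_eq_dotProduct, real_inner_comm] at this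
  obtain ⟨m, hm, hbd⟩ : ∃ m : ℝ, 0 < m ∧ ∀ zv ∈ K ×ˢ Metric.sphere (0 : EuclideanSpace ℝ (Fin n)) 1,
      m ≤ inner ℝ (fderiv ℝ (∇ f) zv.1 zv.2) zv.2 := by
    have hcpt : IsCompact (K ×ˢ Metric.sphere (0 : EuclideanSpace ℝ (Fin n)) 1) :=
      hK.prod (isCompact_sphere _ _)
    -- This form of the extreme value theorem also covers an empty set, as when `n = 0`.
    refine hcpt.exists_forall_le' (a := (0 : ℝ)) ?_ ?_
    · have h1 : ContinuousOn (fun zv : EuclideanSpace ℝ (Fin n) × EuclideanSpace ℝ (Fin n) =>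
          fderiv ℝ (∇ f) zv.1 zv.2) (K ×ˢ Metric.sphere 0 1) :=
        (hD.comp continuousOn_fst fun zv h => h.1).clm_apply continuousOn_snd
      exact h1.inner continuousOn_snd
    · rintro ⟨z, v⟩ ⟨hz, hv⟩
      exact hpos' z hz v (by rintro rfl; simp at hv)
  refine ⟨m, L, hm, fun z hz => ⟨hL z hz, fun v => ?_⟩⟩
  rcases eq_or_ne v 0 with rfl | hv
  · simp
  have hvn : 0 < ‖v‖ := norm_pos_iff.2 hv
  have h1 := hbd (z, ‖v‖⁻¹ • v) ⟨hz, by simp [norm_smul, hvn.ne']⟩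
  simp only [map_smul, inner_smul_left, inner_smul_right, RCLike.conj_to_real] at h1
  calc m * ‖v‖ ^ 2 ≤ (‖v‖⁻¹ * (‖v‖⁻¹ * inner ℝ (fderiv ℝ (∇ f) z v) v)) * ‖v‖ ^ 2 := by gcongr
    _ = _ := by field_simp

/-- On a compact set inside the region of positive definite Hessians, the gradient of a convex
function is cocoercive, even if segments between points leave that region. -/
theorem HasContinuousPosDefHessianOn.exists_cocoercive {n : ℕ}
    {f : EuclideanSpace ℝ (Fin n) → ℝ} {U V K : Set (EuclideanSpace ℝ (Fin n))}
    (hess : HasContinuousPosDefHessianOn f V) (hf : ConvexOn ℝ U f) (hVo : IsOpen V) (hVU : V ⊆ U)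
    (hK : IsCompact K) (hKV : K ⊆ V) :
    ∃ M : ℝ, ∀ p ∈ K, ∀ q ∈ K,
      ‖∇ f q - ∇ f p‖ ^ 2 ≤ M * inner ℝ (q - p) (∇ f q - ∇ f p) := by
  -- Balls of radius `δ` about points of `K` are convex and lie in `V`, so mean value arguments work
  -- inside them.
  obtain ⟨δ, hδ, hδV⟩ := hK.exists_cthickening_subset_open hVo hKV
  obtain ⟨m, L, hm, hbd⟩ := hess.exists_bounds hK.cthickening hδV
  have hball : ∀ p ∈ K, Metric.closedBall p δ ⊆ Metric.cthickening δ K := fun p hp =>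
    Metric.closedBall_subset_cthickening hp δ
  have hdiff : ∀ z ∈ Metric.cthickening δ K, DifferentiableAt ℝ (∇ f) z := fun z hz =>
    (hess.1 z (hδV hz)).2
  have hLip : ∀ p ∈ K, ∀ q ∈ Metric.closedBall p δ, ‖∇ f q - ∇ f p‖ ≤ L * ‖q - p‖ := by
    intro p hp q hq
    exact (convex_closedBall p δ).norm_image_sub_le_of_norm_fderiv_le
      (fun z hz => hdiff z (hball p hp hz)) (fun z hz => (hbd z (hball p hp hz)).1)
      (Metric.mem_closedBall_self hδ.le) hq
  have hmono : ∀ p ∈ K, ∀ q ∈ Metric.closedBall p δ,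
      m * ‖q - p‖ ^ 2 ≤ inner ℝ (q - p) (∇ f q - ∇ f p) := by
    intro p hp q hq
    have hmem : ∀ t ∈ Set.Icc (0 : ℝ) 1, AffineMap.lineMap p q t ∈ Metric.cthickening δ K :=
      fun t ht => hball p hp ((convex_closedBall p δ).lineMap_mem
        (Metric.mem_closedBall_self hδ.le) hq ht)
    have hder : ∀ t ∈ Set.Icc (0 : ℝ) 1,
        HasDerivAt (fun t : ℝ => inner ℝ (q - p) (∇ f (AffineMap.lineMap p q t)))
          (inner ℝ (q - p) (fderiv ℝ (∇ f) (AffineMap.lineMap p q t) (q - p))) t := by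
      intro t ht
      have h1 := (hdiff _ (hmem t ht)).hasFDerivAt.comp_hasDerivAt t
        (AffineMap.hasDerivAt_lineMap (a := p) (b := q))
      simpa using (hasDerivAt_const t (q - p)).inner ℝ h1
    obtain ⟨c, hc, hceq⟩ := exists_hasDerivAt_eq_slope _ _ (zero_lt_one (α := ℝ))
      (fun t ht => (hder t ht).continuousAt.continuousWithinAt)
      (fun t ht => hder t (Set.Ioo_subset_Icc_self ht))
    have h2 := (hbd _ (hmem c (Set.Ioo_subset_Icc_self hc))).2 (q - p)
    rw [real_inner_comm, hceq] at h2
    simpa [inner_sub_right] using h2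
  have hgc : ContinuousOn (∇ f) K := fun z hz =>
    (hess.1 z (hKV hz)).2.continuousAt.continuousWithinAt
  obtain ⟨G, hG⟩ := hK.exists_bound_of_continuousOn hgc
  refine ⟨max (L ^ 2 / m) ((2 * G) ^ 2 / (m * δ ^ 2)), fun p hp q hq => ?_⟩
  have hnn : 0 ≤ inner ℝ (q - p) (∇ f q - ∇ f p) := by
    rw [real_inner_comm]
    exact hf.inner_gradient_sub_nonneg (hVU (hKV hp)) (hVU (hKV hq)) (hess.1 p (hKV hp)).1
      (hess.1 q (hKV hq)).1
  rcases le_or_gt ‖q - p‖ δ with hnear | hfar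
  · have hqb : q ∈ Metric.closedBall p δ := by rwa [mem_closedBall_iff_norm]
    calc ‖∇ f q - ∇ f p‖ ^ 2 ≤ (L * ‖q - p‖) ^ 2 := by
          gcongr; exact hLip p hp q hqb
      _ = L ^ 2 / m * (m * ‖q - p‖ ^ 2) := by field_simp
      _ ≤ L ^ 2 / m * inner ℝ (q - p) (∇ f q - ∇ f p) := by
          gcongr; exact hmono p hp q hqb
      _ ≤ _ := by gcongr; exact le_max_left _ _
  -- For distant points, let `r` be the point of the segment at distance `δ` from `p`. Strong
  -- monotonicity from `p` to `r` and plain monotonicity from `r` to `q` bound the inner product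
  -- below by `m δ²`, while the gradients are bounded on `K`.
  · have hs : 0 < ‖q - p‖ := hδ.trans hfar
    set τ := δ / ‖q - p‖ with hτ
    have hτ0 : 0 < τ := div_pos hδ hs
    have hτ1 : τ < 1 := (div_lt_one hs).2 hfar
    set r := p + τ • (q - p) with hr
    have hrp : r - p = τ • (q - p) := by rw [hr]; abel
    have hqr : q - r = (1 - τ) • (q - p) := by rw [hr, sub_smul, one_smul]; abel
    have hrn : ‖r - p‖ = δ := by
      rw [hrp, norm_smul, Real.norm_of_nonneg hτ0.le, hτ]; field_simp
    have hrb : r ∈ Metric.closedBall p δ := by rw [mem_closedBall_iff_norm, hrn]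
    have hrV : r ∈ V := hδV (hball p hp hrb)
    have h1 := hmono p hp r hrb
    rw [hrn, hrp, inner_smul_left, RCLike.conj_to_real] at h1
    have h2 := hf.inner_gradient_sub_nonneg (hVU hrV) (hVU (hKV hq)) (hess.1 r hrV).1
      (hess.1 q (hKV hq)).1
    rw [hqr, inner_smul_right, real_inner_comm] at h2
    have h3 := nonneg_of_mul_nonneg_right h2 (sub_pos.2 hτ1)
    have h4 : 0 ≤ inner ℝ (q - p) (∇ f r - ∇ f p) := by
      refine nonneg_of_mul_nonneg_right (le_trans ?_ h1) hτ0
      positivity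
    have h5 : m * δ ^ 2 ≤ inner ℝ (q - p) (∇ f q - ∇ f p) := by
      have : inner ℝ (q - p) (∇ f q - ∇ f p) =
          inner ℝ (q - p) (∇ f q - ∇ f r) + inner ℝ (q - p) (∇ f r - ∇ f p) := by
        rw [← inner_add_right]; congr 1; abel
      nlinarith
    have h6 : ‖∇ f q - ∇ f p‖ ≤ 2 * G := by
      linarith [norm_sub_le (∇ f q) (∇ f p), hG p hp, hG q hq]
    calc ‖∇ f q - ∇ f p‖ ^ 2 ≤ (2 * G) ^ 2 := by gcongr
      _ = (2 * G) ^ 2 / (m * δ ^ 2) * (m * δ ^ 2) := by field_simp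
      _ ≤ (2 * G) ^ 2 / (m * δ ^ 2) * inner ℝ (q - p) (∇ f q - ∇ f p) := by gcongr
      _ ≤ _ := by gcongr; exact le_max_right _ _

/-! ### Convergence -/

/-- If `ψ` is nonnegative and increases by at most `C - log (a k / p k)` at step `k`, where
`p k → 0`, then `a` is not bounded away from zero. -/
theorem exists_lt_of_nonneg_of_log_decrease {ψ p a : ℕ → ℝ} {C ε : ℝ} (hψ : ∀ k, 0 ≤ ψ k)
    (hp : ∀ k, 0 < p k) (hp0 : Tendsto p atTop (𝓝 0)) (hε : 0 < ε)
    (hdec : ∀ k, ψ (k + 1) ≤ ψ k + C - Real.log (a k / p k)) : ∃ k, a k < ε := by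
  by_contra! hcon
  -- Below this threshold `log (a k / p k) ≥ C + 1`, so `ψ` drops by at least 1 at each step.
  have hev : ∀ᶠ k in atTop, p k < ε * Real.exp (-(C + 1)) :=
    hp0.eventually_lt_const (by positivity)
  obtain ⟨N, hN⟩ := eventually_atTop.1 hev
  have hdrop : ∀ k ≥ N, ψ (k + 1) ≤ ψ k - 1 := by
    intro k hk
    have h1 : Real.exp (C + 1) ≤ a k / p k := by
      rw [le_div_iff₀ (hp k)]
      calc Real.exp (C + 1) * p k ≤ Real.exp (C + 1) * (ε * Real.exp (-(C + 1))) := by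
            gcongr; exact (hN k hk).le
        _ = ε := by rw [Real.exp_neg]; field_simp
        _ ≤ a k := hcon k
    have h2 := (Real.le_log_iff_exp_le ((Real.exp_pos _).trans_le h1)).2 h1
    linarith [hdec k]
  have hlin : ∀ j : ℕ, ψ (N + j) ≤ ψ N - j := by
    intro j
    induction j with
    | zero => simp
    | succ j ih =>
      have := hdrop (N + j) (Nat.le_add_right _ _)
      rw [← add_assoc]
      push_cast
      linarith
  obtain ⟨j, hj⟩ := exists_nat_gt (ψ N)
  linarith [hlin j, hψ (N + j)]

theorem theorem2 {n : ℕ} (U V : Set (EuclideanSpace ℝ (Fin n)))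
    (f : EuclideanSpace ℝ (Fin n) → ℝ) (x : ℕ → EuclideanSpace ℝ (Fin n))
    (hUo : IsOpen U) (hUc : Convex ℝ U) (hf : ConvexOn ℝ U f)
    (hxU : ∀ k, x k ∈ U) (hx : IsBFGSSequence f x)
    (hlev : Bornology.IsBounded {z ∈ U | f z ≤ f (x 0)})
    (hVo : IsOpen V) (hVU : V ⊆ U) (hxV : closure (Set.range x) ⊆ V)
    (hess : HasContinuousPosDefHessianOn f V)
    (hinf : sInf (f '' V) = sInf (f '' U)) :
    ∃ xmin ∈ U, IsMinOn f U xmin ∧ Tendsto (fun k => f (x k)) atTop (𝓝 (f xmin)) := by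
  obtain ⟨hd, μ, ν, H₀, hμ, hμν, hν, hH₀, hstep⟩ := hx
  choose hdir harm hwol using hstep
  choose t ht hdir using hdir
  have hwol' : ∀ k, (1 - ν) * -inner ℝ (∇ f (x k)) (x (k + 1) - x k) ≤
      inner ℝ (x (k + 1) - x k) (∇ f (x (k + 1)) - ∇ f (x k)) := by
    intro k
    rw [real_inner_comm (∇ f (x (k + 1)) - ∇ f (x k)), inner_sub_left]
    linarith [hwol k]
  -- Positive definiteness of `H_k` makes the step a descent direction, whence Wolfe gives `sᵀy > 0`
  -- and the induction continues.
  have hpd : ∀ k, (bfgsMatrix f x H₀ k).PosDef := by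
    intro k
    induction k with
    | zero => exact hH₀
    | succ k ih =>
      refine bfgsUpdate_posDef ih ?_
      rw [← inner_eq_dotProduct]
      exact lt_of_lt_of_le (mul_pos (sub_pos.2 hν)
        (neg_pos.2 (bfgs_step_descent ih (ht k) (hd k).2 (hdir k)).2)) (hwol' k)
  have hdesc : ∀ k, inner ℝ (∇ f (x k)) (x (k + 1) - x k) < 0 := fun k =>
    (bfgs_step_descent (hpd k) (ht k) (hd k).2 (hdir k)).2
  have hanti : Antitone fun k => f (x k) := antitone_nat_of_succ_le fun k => by
    nlinarith [harm k, hdesc k]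
  set K := closure (Set.range x) with hK
  have hxK : ∀ k, x k ∈ K := fun k => subset_closure ⟨k, rfl⟩
  have hKc : IsCompact K := by
    refine Metric.isCompact_of_isClosed_isBounded isClosed_closure (hlev.subset ?_).closure
    rintro _ ⟨k, rfl⟩
    exact ⟨hxU k, hanti (Nat.zero_le k)⟩
  obtain ⟨M, hM⟩ := hess.exists_cocoercive hf hVo hVU hKc hxV
  have hfc : ContinuousOn f K := fun z hz =>
    (hess.1 z (hxV hz)).1.continuousAt.continuousWithinAt
  have hgc : ContinuousOn (∇ f) K := fun z hz =>
    (hess.1 z (hxV hz)).2.continuousAt.continuousWithinAt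
  have hp0 : Tendsto (fun k => -inner ℝ (∇ f (x k)) (x (k + 1) - x k)) atTop (𝓝 0) := by
    have hbdd : BddBelow (Set.range fun k => f (x k)) :=
      (hKc.bddBelow_image hfc).mono (by rintro _ ⟨k, rfl⟩; exact ⟨x k, hxK k, rfl⟩)
    have hl := tendsto_atTop_ciInf hanti hbdd
    have h1 : Tendsto (fun k => (f (x k) - f (x (k + 1))) / μ) atTop (𝓝 0) := by
      simpa using (hl.sub (hl.comp (tendsto_add_atTop_nat 1))).div_const μ
    refine squeeze_zero (fun k => (neg_pos.2 (hdesc k)).le) (fun k => ?_) h1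
    rw [le_div_iff₀ hμ]
    linarith [harm k]
  have hsmall : ∀ ε > 0, ∃ k, ‖∇ f (x k)‖ ^ 2 < ε := fun ε hε =>
    exists_lt_of_nonneg_of_log_decrease (ψ := fun k => bfgsPotential (bfgsMatrix f x H₀ k))
      (C := M - Real.log (1 - ν) - 1) (fun k => bfgsPotential_nonneg (hpd k))
      (fun k => neg_pos.2 (hdesc k)) hp0 hε fun k => by
        have := bfgsPotential_update_le (hpd k) (ht k) (hd k).2 (hdir k) hν (hwol' k)
          (hM _ (hxK k) _ (hxK (k + 1)))
        simp only [bfgsMatrix]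
        linarith
  obtain ⟨z, hzK, hz⟩ := hKc.exists_isMinOn ⟨x 0, hxK 0⟩ hgc.norm
  have hgz : ∇ f z = 0 := by
    by_contra hne
    obtain ⟨k, hk⟩ := hsmall (‖∇ f z‖ ^ 2) (by positivity)
    have h1 : ‖∇ f z‖ ≤ ‖∇ f (x k)‖ := hz (hxK k)
    exact absurd hk (not_lt.2 (by gcongr))
  have hzV : z ∈ V := hxV hzK
  have hmin : IsMinOn f U z := fun q hq => by
    simpa [hgz] using hf.add_inner_gradient_le (hVU hzV) hq (hess.1 z hzV).1
  refine ⟨z, hVU hzV, hmin, tendsto_order.2 ⟨fun b hb => ?_, fun b hb => ?_⟩⟩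
  · exact Eventually.of_forall fun k => hb.trans_le (hmin (hxU k))
  -- One iterate near `z` suffices, as later values are no larger.
  · have hnear : ∀ᶠ w in 𝓝 z, f w < b :=
      (hess.1 z hzV).1.continuousAt.eventually_lt_const hb
    obtain ⟨_, hw, k, rfl⟩ := mem_closure_iff_nhds.1 hzK _ hnear
    exact eventually_atTop.2 ⟨k, fun j hj => (hanti hj).trans_lt hw⟩
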